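/- Let $n\ge 1$ and let $\rho$ be a partition of $\{1,\dots,n\}$ with $|\rho|$ blocks; let $b(k)$ denote the block containing $k$, indices being cyclic modulo $n$ (so $b(0)=b(n)$, $x_0=x_n$). For $N\ge 1$ put $$K_{\rho,u,N}=\frac{1}{N^{\,n+1-|\rho|}}\;\mathbb E\left[\prod_{k=1}^n \frac{1-e^{iN(\omega_{b(k-1)}-\omega_{b(k)})}}{1-e^{i(\omega_{b(k-1)}-\omega_{b(k)})}}\right],$$ where the $\omega_W$, $W$ a block of $\rho$, are independent and uniformly distributed on $[0,2\pi)$, and each quotient is read as its limit value $N$ where its denominator vanishes. Call $\rho$ noncrossing if, whenever $i<j<k<l$ with $i,k$ in the same block and $j,l$ in the same block, all of $i,j,k,l$ are in the same block. Then the limit $K_{\rho,u}=\lim_{N\to\infty}K_{\rho,u,N}$ exists. It is a rational number with $0<K_{\rho,u}\le 1$, and $K_{\rho,u}=1$ if and only if $\rho$ is noncrossing. Moreover, the system of linear equations $\sum_{k\in W}x_{k-1}=\sum_{k\in W}x_k$ ($W$ running through the blocks of $\rho$) has a solution space in $\mathbb R^n$ of dimension $n+1-|\rho|$, and $K_{\rho,u}$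 is the volume in $\mathbb R^{n+1-|\rho|}$ of the polytope $$\Big\{x\in[0,1]^n:\ \sum_{k\in W}x_{k-1}=\sum_{k\in W}x_k\ \text{ for each block } W \text{ of } \rho\Big\},$$ measured in the coordinates of the free variables: a set $F\subseteq\{1,\dots,n\}$ such that the variables $(x_k)_{k\in F}$ can be prescribed arbitrarily and then determine the solution exists, and for every such $F$ one has $|F|=n+1-|\rho|$ and the Lebesgue measure of the projection of the polytope to $\mathbb R^F$ equals $K_{\rho,u}$. -/

import Mathlib

namespace VandermondeMoments

open MeasureTheory

/-- The set `{1, …, n}`, written `Fin n` with its cyclic successor/predecessor and its usual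
order, is partitioned by `ρ`; `block ρ k` is the block `b(k)` of `ρ` which contains `k`. -/
def block {n : ℕ} (ρ : Finpartition (Finset.univ : Finset (Fin n))) (k : Fin n) : ρ.parts :=
  ⟨ρ.part k, ρ.part_mem.2 (Finset.mem_univ k)⟩

/-- `ρ` is noncrossing: `i < j < k < l`, `i ∼ k` and `j ∼ l` force `i ∼ j ∼ k ∼ l`. -/
def IsNoncrossing {n : ℕ} (ρ : Finpartition (Finset.univ : Finset (Fin n))) : Prop :=
  ∀ i j k l : Fin n, i < j → j < k → k < l →
    block ρ i = block ρ k → block ρ j = block ρ l →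
      block ρ i = block ρ j ∧ block ρ j = block ρ k ∧ block ρ k = block ρ l

/-- The function `θ ↦ (1 - e^{iNθ}) / (1 - e^{iθ})`, with its removable singularities at the
multiples of `2π` filled in by the limit value `N`. -/
noncomputable def phaseFactor (N : ℕ) (θ : ℝ) : ℂ :=
  open Classical in
  if Complex.exp (Complex.I * θ) = 1 then (N : ℂ)
  else (1 - Complex.exp (Complex.I * (N * θ))) / (1 - Complex.exp (Complex.I * θ))

/-- `phaseFactor` is the geometric sum `∑_{r < N} e^{irθ}`. -/
theorem phaseFactor_eq_sum (N : ℕ) (θ : ℝ) :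
    phaseFactor N θ = ∑ r ∈ Finset.range N, Complex.exp (Complex.I * (r * θ)) := by
  have key : ∀ r : ℕ, Complex.exp (Complex.I * (r * θ)) = Complex.exp (Complex.I * θ) ^ r := by
    intro r
    rw [← Complex.exp_nat_mul]
    ring_nf
  simp only [phaseFactor, key]
  split_ifs with h
  · simp [h]
  · rw [geom_sum_eq h, ← neg_sub, ← neg_sub (Complex.exp (Complex.I * θ)), neg_div_neg_eq]

/-- The quantity
`K_{ρ,μ,N} = N^{-(n+1-|ρ|)} E ∏_{k=1}^n (1 - e^{iN(ω_{b(k-1)} - ω_{b(k)})}) /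
  (1 - e^{i(ω_{b(k-1)} - ω_{b(k)})})`,
where the phases `ω_W`, indexed by the blocks `W` of `ρ`, are i.i.d. with law `μ`, and `k - 1` is
taken cyclically. -/
noncomputable def coeffN {n : ℕ} [NeZero n] (ρ : Finpartition (Finset.univ : Finset (Fin n)))
    (μ : Measure ℝ) (N : ℕ) : ℂ :=
  1 / (N : ℂ) ^ (n + 1 - ρ.parts.card) *
    ∫ ω : ρ.parts → ℝ, ∏ k : Fin n, phaseFactor N (ω (block ρ (k - 1)) - ω (block ρ k))
      ∂(Measure.pi fun _ => μ)

/-- The uniform distribution on `[0, 2π)`: normalised Lebesgue measure. -/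
noncomputable def uniformPhase : Measure ℝ :=
  ProbabilityTheory.cond volume (Set.Ico 0 (2 * Real.pi))

/-- The real solutions of the system `∑_{k ∈ W} x_{k-1} = ∑_{k ∈ W} x_k`, `W` a block of `ρ`
(indices cyclic). -/
def solutionSpace {n : ℕ} [NeZero n] (ρ : Finpartition (Finset.univ : Finset (Fin n))) :
    Submodule ℝ (Fin n → ℝ) where
  carrier := {x | ∀ W ∈ ρ.parts, ∑ k ∈ W, x (k - 1) = ∑ k ∈ W, x k}
  add_mem' := by
    intro x y hx hy W hW
    simp only [Pi.add_apply, Finset.sum_add_distrib, hx W hW, hy W hW]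
  zero_mem' := by
    intro W _
    simp
  smul_mem' := by
    intro c x hx W hW
    simp only [Pi.smul_apply, smul_eq_mul, ← Finset.mul_sum, hx W hW]

/-- The polytope of the solutions of the system in the cube `[0,1]^n`. -/
def polytope {n : ℕ} [NeZero n] (ρ : Finpartition (Finset.univ : Finset (Fin n))) :
    Set (Fin n → ℝ) :=
  {x | (∀ k, 0 ≤ x k ∧ x k ≤ 1) ∧ x ∈ solutionSpace ρ}

/-- The variables `x_k`, `k ∈ F`, are a full set of free variables of the system: their values can
be prescribed arbitrarily, and they determine the solution. -/
def IsFreeVariables {n : ℕ} [NeZero n] (ρ : Finpartition (Finset.univ : Finset (Fin n)))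
    (F : Finset (Fin n)) : Prop :=
  ∀ y : F → ℝ, ∃! x : Fin n → ℝ, x ∈ solutionSpace ρ ∧ ∀ k : F, x k = y k

/-- The volume of the polytope in the coordinates given by the free variables `x_k`, `k ∈ F`, that
is, the Lebesgue measure in `ℝ^F` of its (injective) coordinate projection to `ℝ^F`. -/
noncomputable def polytopeVolume {n : ℕ} [NeZero n]
    (ρ : Finpartition (Finset.univ : Finset (Fin n))) (F : Finset (Fin n)) : ENNReal :=
  volume ((fun (x : Fin n → ℝ) (k : F) => x k) '' polytope ρ)

end VandermondeMoments

set_option linter.unusedSectionVars false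

/-! ### Circulations on the graph of blocks: net flow, spanning set and dimension. -/

namespace VandermondeMoments

open MeasureTheory

variable {n : ℕ} [NeZero n] (ρ : Finpartition (Finset.univ : Finset (Fin n)))

/-! Take the blocks as vertices and each index `k` as an edge from the block of `k` to the block of
`k + 1`. These edges form a closed walk through all vertices, so the graph is connected. The linear
system says that `x` is a circulation; its rank is `|ρ| - 1` (`range_netFlow`), which gives the
dimension.

Each quotient is a geometric sum, and orthogonality of characters keeps only the exponent vectors
that solve the system. So `coeffN` counts the solutions in `{0, …, N - 1}^n`, divided by `N ^ (n + 1
- |ρ|)` (`coeffN_eq`). The edges outside a set `F` of free variables still connect the graph, hence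
the solutions depend on the free variables through an integer matrix
(`IsFreeVariables.exists_matrix`). The count is therefore that of the points of `N⁻¹ ℤ^F` in a
half-open convex body, and the quotient tends to its volume. The sequence does not involve `F`, so
neither does the volume. It is rational because integrating out one variable preserves piecewise
polynomials over `ℚ` (`fiber_integral_mem_piecewisePoly`).

The projected polytope is closed and lies in the unit cube, so its volume is 1 exactly when it is
the whole cube. The solution space is spanned by 1 and the indicators of the segments `[i, k)` with
`i`, `k` in one block. If `ρ` is noncrossing, this span is closed under products; then `∏_{k ∈ F} (x
- x_k)` is a solution vanishing on `F`, hence zero, and all coordinates of `x` are values of free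
variables. Conversely, if the projection is the whole cube and `[i, k)`, `[j, l)` cross, the
solution whose free values are those of the product of the two indicators is forced to be the
indicator of `[j, k)`, so `j` and `k` share a block. -/

theorem block_eq_iff (k : Fin n) (v : ρ.parts) : block ρ k = v ↔ k ∈ v.1 := by
  rw [block, Subtype.ext_iff]
  exact ρ.part_eq_iff_mem v.2

theorem block_surjective : Function.Surjective (block ρ) := by
  intro v
  obtain ⟨k, hk⟩ := ρ.nonempty_of_mem_parts v.2
  exact ⟨k, (block_eq_iff ρ k v).2 hk⟩

/-- The net flow into the blocks, the variable `x k` being a flow from the block of `k` to the block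
of `k + 1`. -/
noncomputable def netFlow : (Fin n → ℝ) →ₗ[ℝ] (ρ.parts → ℝ) where
  toFun x v := ∑ k, if block ρ k = v then x (k - 1) - x k else 0
  map_add' x y := by
    ext v
    simp only [Pi.add_apply, ← Finset.sum_add_distrib]
    refine Finset.sum_congr rfl fun k _ => ?_
    split_ifs <;> ring
  map_smul' c x := by
    ext v
    simp only [Pi.smul_apply, smul_eq_mul, RingHom.id_apply, Finset.mul_sum]
    refine Finset.sum_congr rfl fun k _ => ?_
    split_ifs <;> ring

theorem netFlow_apply (x : Fin n → ℝ) (v : ρ.parts) :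
    netFlow ρ x v = ∑ k, if block ρ k = v then x (k - 1) - x k else 0 := rfl

theorem netFlow_apply_eq_sum_block (x : Fin n → ℝ) (v : ρ.parts) :
    netFlow ρ x v = ∑ k ∈ v.1, x (k - 1) - ∑ k ∈ v.1, x k := by
  rw [netFlow_apply, ← Finset.sum_filter, ← Finset.sum_sub_distrib]
  congr 1
  ext k
  simp [block_eq_iff]

theorem ker_netFlow : LinearMap.ker (netFlow ρ) = solutionSpace ρ := by
  ext x
  rw [LinearMap.mem_ker, funext_iff]
  simp only [netFlow_apply_eq_sum_block, Pi.zero_apply, sub_eq_zero, Subtype.forall]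
  rfl

theorem mem_solutionSpace_iff (x : Fin n → ℝ) : x ∈ solutionSpace ρ ↔ netFlow ρ x = 0 := by
  rw [← ker_netFlow, LinearMap.mem_ker]

theorem sum_netFlow_mul (φ : ρ.parts → ℝ) (x : Fin n → ℝ) :
    ∑ v, φ v * netFlow ρ x v = ∑ k, φ (block ρ k) * (x (k - 1) - x k) := by
  simp only [netFlow_apply, Finset.mul_sum]
  rw [Finset.sum_comm]
  refine Finset.sum_congr rfl fun k _ => ?_
  simp

/-- The adjoint of `netFlow` takes a potential on the blocks to its differences along the edges. -/
theorem sum_netFlow_mul' (φ : ρ.parts → ℝ) (x : Fin n → ℝ) :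
    ∑ v, φ v * netFlow ρ x v = ∑ k, (φ (block ρ (k + 1)) - φ (block ρ k)) * x k := by
  rw [sum_netFlow_mul]
  simp only [mul_sub, sub_mul, Finset.sum_sub_distrib]
  congr 1
  rw [← Equiv.sum_comp (Equiv.addRight (1 : Fin n)) fun k => φ (block ρ k) * x (k - 1)]
  simp

theorem netFlow_single (k : Fin n) (v : ρ.parts) :
    netFlow ρ (Pi.single k 1) v =
      (if block ρ (k + 1) = v then 1 else 0) - if block ρ k = v then 1 else 0 := by
  have := sum_netFlow_mul' ρ (Pi.single v 1) (Pi.single k 1)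
  simpa [Pi.single_apply, eq_comm] using this

/-- The indicator function of the initial segment `{s | s < t}`. -/
def initialIndicator (t : Fin n) : Fin n → ℝ := fun s => if s < t then 1 else 0

/-- The indicator drops at `t` and, because of the cyclic wrap-around, jumps up at `0`; for `t = 0`
the two cancel. -/
theorem initialIndicator_sub (t s : Fin n) :
    initialIndicator t (s - 1) - initialIndicator t s =
      (if s = t then 1 else 0) - if s = 0 then 1 else 0 := by
  obtain ⟨m, rfl⟩ := Nat.exists_eq_succ_of_ne_zero (NeZero.ne n)
  unfold initialIndicator
  by_cases hs : s = 0
  · subst hs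
    have h1 : ¬ ((0 : Fin (m + 1)) - 1 < t) := by
      rw [zero_sub, Fin.lt_def, Fin.coe_neg_one]
      exact not_lt.2 t.is_le
    by_cases ht : t = 0
    · simp [ht]
    · have : 0 < t := Fin.pos_of_ne_zero ht
      rw [if_neg h1, if_pos this, if_neg (Ne.symm ht), if_pos rfl]
  · have h1 : (s - 1 < t) ↔ s < t ∨ s = t := by
      have := Fin.val_sub_one_of_ne_zero hs
      have h0 : s.val ≠ 0 := fun h => hs (Fin.ext h)
      simp only [Fin.lt_def, Fin.ext_iff, this]
      omega
    by_cases h2 : s = t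
    · subst h2; simp [hs, h1]
    · simp [hs, h1, h2]

theorem netFlow_initialIndicator (t : Fin n) (v : ρ.parts) :
    netFlow ρ (initialIndicator t) v =
      (if block ρ t = v then 1 else 0) - if block ρ 0 = v then 1 else 0 := by
  rw [netFlow_apply]
  simp only [initialIndicator_sub]
  have : ∀ k : Fin n, (if block ρ k = v then
      ((if k = t then 1 else 0) - if k = 0 then 1 else 0 : ℝ) else 0) =
      (if k = t then (if block ρ t = v then 1 else 0) else 0) -
      if k = 0 then (if block ρ 0 = v then 1 else 0) else 0 := by
    intro k
    by_cases h1 : k = t <;> by_cases h2 : k = 0 <;> simp [h1, h2]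
    · subst h1; simp [h2]
    · subst h1; split_ifs <;> simp
    · rw [h2] at h1; simp [h1]; split_ifs <;> simp
  simp [this, Finset.sum_sub_distrib]

theorem initialIndicator_sub_mem {i k : Fin n} :
    initialIndicator k - initialIndicator i ∈ solutionSpace ρ ↔ block ρ i = block ρ k := by
  rw [mem_solutionSpace_iff, map_sub, sub_eq_zero]
  constructor
  · intro h
    have := congrFun h (block ρ k)
    simp only [netFlow_initialIndicator, if_true] at this
    by_contra hne
    simp [hne] at this
  · intro h
    ext v
    simp [netFlow_initialIndicator, h]

theorem const_mem_solutionSpace (c : ℝ) : (fun _ => c) ∈ solutionSpace ρ := by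
  intro W _
  rfl

theorem eq_const_of_sub_eq_zero (x : Fin n → ℝ) (h : ∀ k, x (k - 1) - x k = 0) (k : Fin n) :
    x k = x 0 := by
  obtain ⟨m, rfl⟩ := Nat.exists_eq_succ_of_ne_zero (NeZero.ne n)
  induction k using Fin.induction with
  | zero => rfl
  | succ i ih =>
    have := h i.succ
    rw [← ih, ← sub_eq_zero.1 this]
    congr 1
    rw [Fin.ext_iff, Fin.val_sub_one_of_ne_zero (Fin.succ_ne_zero i)]
    simp

theorem sum_sub_pred (x : Fin n → ℝ) : ∑ k, (x (k - 1) - x k) = 0 := by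
  rw [Finset.sum_sub_distrib, sub_eq_zero]
  exact (Equiv.subRight (1 : Fin n)).sum_comp x

/-- Both sides have the same cyclic differences: the contributions at `0` cancel since the
differences of `x` sum to zero. -/
theorem exists_eq_const_add_sum_initialIndicator (x : Fin n → ℝ) :
    ∃ c : ℝ, x = (fun _ => c) + ∑ t, (x (t - 1) - x t) • initialIndicator t := by
  set y := x - ∑ t, (x (t - 1) - x t) • initialIndicator t with hy
  have h : ∀ k, y (k - 1) - y k = 0 := by
    intro k
    have e : y (k - 1) - y k = (x (k - 1) - x k) -
        ∑ t, (x (t - 1) - x t) * (initialIndicator t (k - 1) - initialIndicator t k) := by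
      simp only [hy, Pi.sub_apply, Finset.sum_apply, Pi.smul_apply, smul_eq_mul, mul_sub,
        Finset.sum_sub_distrib]
      ring
    rw [e]
    simp only [initialIndicator_sub, mul_sub, Finset.sum_sub_distrib, ← Finset.sum_mul]
    have h0 := sum_sub_pred x
    rw [Finset.sum_sub_distrib] at h0
    rw [h0]
    simp
  refine ⟨y 0, ?_⟩
  have : (fun _ => y 0) = y := by
    ext k
    exact (eq_const_of_sub_eq_zero y h k).symm
  rw [this, hy]
  abel

/-- A representative of each block. -/
noncomputable def blockRep (v : ρ.parts) : Fin n := (block_surjective ρ v).choose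

theorem block_blockRep (v : ρ.parts) : block ρ (blockRep ρ v) = v :=
  (block_surjective ρ v).choose_spec

theorem solutionSpace_eq_span :
    solutionSpace ρ = Submodule.span ℝ ({fun _ => 1} ∪
      {x | ∃ i k, block ρ i = block ρ k ∧ x = initialIndicator k - initialIndicator i}) := by
  apply le_antisymm
  · intro x hx
    obtain ⟨c, hc⟩ := exists_eq_const_add_sum_initialIndicator x
    -- For a solution the differences sum to zero over each block, so replacing every `t` by its
    -- block's representative gives zero. Subtracting this sum turns each initial indicator into a
    -- difference within one block.
    have h0 : ∑ t, (x (t - 1) - x t) • initialIndicator (blockRep ρ (block ρ t)) = 0 := by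
      ext s
      have := sum_netFlow_mul ρ (fun v => initialIndicator (blockRep ρ v) s) x
      rw [(mem_solutionSpace_iff ρ x).1 hx] at this
      simp only [Pi.zero_apply, mul_zero, Finset.sum_const_zero] at this
      simp only [Finset.sum_apply, Pi.smul_apply, smul_eq_mul, Pi.zero_apply]
      rw [this]
      exact Finset.sum_congr rfl fun _ _ => mul_comm _ _
    rw [hc, ← sub_zero (∑ t, _), ← h0, ← Finset.sum_sub_distrib]
    refine Submodule.add_mem _ ?_ (Submodule.sum_mem _ fun t _ => ?_)
    · have : (fun _ : Fin n => c) = c • (fun _ : Fin n => (1 : ℝ)) := by ext; simp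
      rw [this]
      exact Submodule.smul_mem _ _ (Submodule.subset_span (Or.inl rfl))
    · rw [← smul_sub]
      exact Submodule.smul_mem _ _ (Submodule.subset_span
        (Or.inr ⟨_, _, block_blockRep ρ _, rfl⟩))
  · rw [Submodule.span_le]
    rintro x (rfl | ⟨i, k, h, rfl⟩)
    · exact const_mem_solutionSpace ρ 1
    · exact (initialIndicator_sub_mem ρ).2 h

theorem range_netFlow :
    LinearMap.range (netFlow ρ) = LinearMap.ker (∑ v : ρ.parts, LinearMap.proj (R := ℝ) v) := by
  ext g
  simp only [LinearMap.mem_range, LinearMap.mem_ker, LinearMap.coe_sum, Finset.sum_apply,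
    LinearMap.coe_proj, Function.eval]
  constructor
  · rintro ⟨x, rfl⟩
    have := sum_netFlow_mul ρ (fun _ => 1) x
    simp only [one_mul] at this
    rw [this, sum_sub_pred]
  · intro hg
    -- Each summand also has a sink at the block of `0`; these cancel because `g` has total zero.
    refine ⟨∑ v, g v • initialIndicator (blockRep ρ v), ?_⟩
    ext w
    simp only [map_sum, map_smul, Finset.sum_apply, Pi.smul_apply, smul_eq_mul,
      netFlow_initialIndicator, block_blockRep, mul_sub, Finset.sum_sub_distrib, ← Finset.sum_mul,
      hg]
    simp

theorem finrank_solutionSpace :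
    Module.finrank ℝ (solutionSpace ρ) = n + 1 - ρ.parts.card := by
  have h1 := LinearMap.finrank_range_add_finrank_ker (netFlow ρ)
  have hne : (∑ v : ρ.parts, LinearMap.proj (R := ℝ) (φ := fun _ => ℝ) v :
      Module.Dual ℝ (ρ.parts → ℝ)) ≠ 0 := by
    intro h
    have := LinearMap.congr_fun h (Pi.single (block ρ 0) 1)
    simp [LinearMap.sum_apply] at this
  have h2 := Module.Dual.finrank_ker_add_one_of_ne_zero hne
  rw [← range_netFlow] at h2
  rw [ker_netFlow] at h1
  simp only [Module.finrank_fintype_fun_eq_card, Fintype.card_fin, Fintype.card_coe] at h1 h2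
  omega

end VandermondeMoments

/-! ### Free variables and integrality. -/

namespace VandermondeMoments

open MeasureTheory

variable {n : ℕ} [NeZero n] (ρ : Finpartition (Finset.univ : Finset (Fin n)))

/-- Some set of coordinates restricts bijectively to a given subspace of `ℝ^n`. -/
theorem exists_coordinates_bijective {ι : Type*} [Fintype ι] (S : Submodule ℝ (ι → ℝ)) :
    ∃ F : Finset ι, Function.Bijective fun (x : S) (k : F) => x.1 k := by
  classical
  let c : ι → Module.Dual ℝ S := fun k => (LinearMap.proj k).comp S.subtype
  -- A basis of the span of the coordinate functionals: spanning makes the restriction injective,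
  -- independence makes the dimensions agree.
  obtain ⟨κ, a, ha, hspan, hli⟩ := exists_linearIndependent' ℝ c
  have : Finite κ := Finite.of_injective a ha
  have := Fintype.ofFinite κ
  have hinj : ∀ x : S, (∀ i, x.1 (a i) = 0) → x = 0 := by
    intro x hx
    have h : Submodule.span ℝ (Set.range (c ∘ a)) ≤
        LinearMap.ker (Module.Dual.eval ℝ S x) := by
      rw [Submodule.span_le]
      rintro _ ⟨i, rfl⟩
      exact hx i
    rw [hspan] at h
    ext k
    exact h (Submodule.subset_span ⟨k, rfl⟩)
  let r : S →ₗ[ℝ] (κ → ℝ) := LinearMap.pi (c ∘ a)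
  have hr : Function.Injective r := by
    rw [← LinearMap.ker_eq_bot, LinearMap.ker_eq_bot']
    exact fun x hx => hinj x fun i => congrFun hx i
  have hcard : Module.finrank ℝ S = Module.finrank ℝ (κ → ℝ) := by
    apply le_antisymm (LinearMap.finrank_le_finrank_of_injective hr)
    have := hli.fintype_card_le_finrank
    rwa [Subspace.dual_finrank_eq, ← Module.finrank_fintype_fun_eq_card ℝ] at this
  have hsurj := (LinearMap.injective_iff_surjective_of_finrank_eq_finrank hcard).1 hr
  refine ⟨Finset.univ.image a, ?_, ?_⟩
  · intro x y hxy
    exact hr (funext fun i => congrFun hxy ⟨a i, by simp⟩)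
  · intro y
    obtain ⟨x, hx⟩ := hsurj fun i => y ⟨a i, by simp⟩
    refine ⟨x, ?_⟩
    ext ⟨k, hk⟩
    obtain ⟨i, -, rfl⟩ := Finset.mem_image.1 hk
    exact congrFun hx i

theorem isFreeVariables_iff_bijective (F : Finset (Fin n)) :
    IsFreeVariables ρ F ↔ Function.Bijective fun (x : solutionSpace ρ) (k : F) => x.1 k := by
  rw [Function.bijective_iff_existsUnique]
  refine forall_congr' fun y => ?_
  constructor
  · rintro ⟨x, ⟨hx, hxy⟩, hu⟩
    exact ⟨⟨x, hx⟩, funext hxy, fun z hz => Subtype.ext (hu z.1 ⟨z.2, congrFun hz⟩)⟩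
  · rintro ⟨x, hx, hu⟩
    exact ⟨x.1, ⟨x.2, congrFun hx⟩,
      fun z hz => congrArg Subtype.val (hu ⟨z, hz.1⟩ (funext hz.2))⟩

theorem exists_isFreeVariables : ∃ F : Finset (Fin n), IsFreeVariables ρ F := by
  simp only [isFreeVariables_iff_bijective]
  exact exists_coordinates_bijective _

variable {ρ} {F : Finset (Fin n)}

theorem IsFreeVariables.card_eq (hF : IsFreeVariables ρ F) :
    F.card = n + 1 - ρ.parts.card := by
  rw [← finrank_solutionSpace]
  rw [isFreeVariables_iff_bijective] at hF
  let r : solutionSpace ρ →ₗ[ℝ] (F → ℝ) :=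
    LinearMap.pi fun k => (LinearMap.proj k.1).comp (solutionSpace ρ).subtype
  have := (LinearEquiv.ofBijective r hF).finrank_eq
  simpa using this.symm

theorem IsFreeVariables.eq_of_eqOn (hF : IsFreeVariables ρ F) {x y : Fin n → ℝ}
    (hx : x ∈ solutionSpace ρ) (hy : y ∈ solutionSpace ρ) (h : ∀ k ∈ F, x k = y k) : x = y :=
  (hF fun k => y k).unique ⟨hx, fun k => h k k.2⟩ ⟨hy, fun _ => rfl⟩

/-- Connectedness of the graph: the walk `0, 1, …, n - 1` meets every block. -/
theorem block_eq_of_forall_succ {α : Type*} (φ : ρ.parts → α)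
    (h : ∀ k, φ (block ρ (k + 1)) = φ (block ρ k)) (v w : ρ.parts) : φ v = φ w := by
  have key : ∀ k, φ (block ρ k) = φ (block ρ 0) := by
    obtain ⟨m, rfl⟩ := Nat.exists_eq_succ_of_ne_zero (NeZero.ne n)
    intro k
    induction k using Fin.induction with
    | zero => rfl
    | succ i ih =>
      rw [← ih, ← h i.castSucc, Fin.coeSucc_eq_succ]
  obtain ⟨i, rfl⟩ := block_surjective ρ v
  obtain ⟨j, rfl⟩ := block_surjective ρ w
  rw [key i, key j]

/-- The edges outside `F` connect all blocks, since a cut crossed only by edges in `F` would impose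
a relation on the free variables. The flow is a signed path, hence integral. -/
theorem IsFreeVariables.exists_netFlow_eq (hF : IsFreeVariables ρ F) (v w : ρ.parts) :
    ∃ z : Fin n → ℤ, (∀ k ∈ F, z k = 0) ∧
      netFlow ρ (fun k => (z k : ℝ)) = Pi.single v 1 - Pi.single w 1 := by
  let r : ρ.parts → ρ.parts → Prop := fun v w => ∃ z : Fin n → ℤ, (∀ k ∈ F, z k = 0) ∧
      netFlow ρ (fun k => (z k : ℝ)) = Pi.single v 1 - Pi.single w 1
  have hrefl : ∀ v, r v v := fun v => ⟨0, fun _ _ => rfl, by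
    rw [sub_self]
    convert! map_zero (netFlow ρ)
    simp⟩
  have hsymm : ∀ v w, r v w → r w v := by
    rintro v w ⟨z, hz, h⟩
    refine ⟨-z, fun k hk => by simp [hz k hk], ?_⟩
    rw [← neg_sub, ← h, ← map_neg]
    congr 1
    ext; simp
  have htrans : ∀ u v w, r u v → r v w → r u w := by
    rintro u v w ⟨z, hz, h⟩ ⟨z', hz', h'⟩
    refine ⟨z + z', fun k hk => by simp [hz k hk, hz' k hk], ?_⟩
    rw [← sub_add_sub_cancel _ (Pi.single v 1), ← h, ← h', ← map_add]
    congr 1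
    ext; simp
  have hsucc : ∀ k ∉ F, r (block ρ (k + 1)) (block ρ k) := by
    intro k hk
    refine ⟨Pi.single k 1, ?_, ?_⟩
    · intro j hj
      exact Pi.single_eq_of_ne (ne_of_mem_of_not_mem hj hk) _
    · ext v
      have e : (fun j => ((Pi.single k 1 : Fin n → ℤ) j : ℝ)) = Pi.single k 1 := by
        ext j
        by_cases h : j = k
        · subst h; simp
        · simp [h]
      rw [e, netFlow_single]
      simp [Pi.single_apply, eq_comm]
  classical
  -- The component of `w` under edges outside `F`. Pairing its indicator with the solution whose
  -- only nonzero free value is at `k ∈ F` shows that `k` does not leave it either.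
  let φ : ρ.parts → ℝ := fun u => if r u w then 1 else 0
  have hout : ∀ k ∉ F, φ (block ρ (k + 1)) = φ (block ρ k) := by
    intro k hk
    have : r (block ρ (k + 1)) w ↔ r (block ρ k) w :=
      ⟨htrans _ _ _ (hsymm _ _ (hsucc k hk)), htrans _ _ _ (hsucc k hk)⟩
    simp only [φ, this]
  have hin : ∀ k ∈ F, φ (block ρ (k + 1)) = φ (block ρ k) := by
    intro k hk
    obtain ⟨x, ⟨hx, hxy⟩, -⟩ := hF (Pi.single ⟨k, hk⟩ 1)
    have := sum_netFlow_mul' ρ φ x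
    rw [(mem_solutionSpace_iff ρ x).1 hx] at this
    rw [Finset.sum_eq_single k] at this
    · have h1 : x k = 1 := by simpa using hxy ⟨k, hk⟩
      simp only [Pi.zero_apply, mul_zero, Finset.sum_const_zero, h1, mul_one] at this
      linarith
    · intro j _ hjk
      by_cases hj : j ∈ F
      · have : x j = 0 := by
          have := hxy ⟨j, hj⟩
          rwa [Pi.single_eq_of_ne (by simpa using hjk)] at this
        rw [this, mul_zero]
      · rw [hout j hj, sub_self, zero_mul]
    · simp
  have hall := block_eq_of_forall_succ φ
    (fun k => if hk : k ∈ F then hin k hk else hout k hk) v w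
  by_contra hv
  have hv' : ¬ r v w := hv
  simp [φ, hv', hrefl w] at hall

/-- The solutions depend on the free variables through an integer matrix. -/
theorem IsFreeVariables.exists_matrix (hF : IsFreeVariables ρ F) :
    ∃ A : Matrix (Fin n) F ℤ,
      (∀ y : F → ℝ, (fun j => ∑ k, (A j k : ℝ) * y k) ∈ solutionSpace ρ) ∧
      (∀ (y : F → ℝ) (j : F), ∑ k, (A j k : ℝ) * y k = y j) ∧
      ∀ x ∈ solutionSpace ρ, ∀ j, x j = ∑ k, (A j k : ℝ) * x k := by
  choose z hz hz' using hF.exists_netFlow_eq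
  -- Column `k` is a fundamental cycle: the edge `k`, closed up by an integer flow outside `F` with
  -- the same net flow.
  let A : Matrix (Fin n) F ℤ := fun j k =>
    (Pi.single k.1 1 : Fin n → ℤ) j - z (block ρ (k.1 + 1)) (block ρ k.1) j
  have h1 : ∀ y : F → ℝ, (fun j => ∑ k, (A j k : ℝ) * y k) ∈ solutionSpace ρ := by
    intro y
    have e : (fun j => ∑ k, (A j k : ℝ) * y k) = ∑ k, y k • fun j => (A j k : ℝ) := by
      ext j
      simp [mul_comm]
    rw [e]
    refine Submodule.sum_mem _ fun k _ => Submodule.smul_mem _ _ ?_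
    rw [mem_solutionSpace_iff]
    have e2 : (fun j => (A j k : ℝ)) = Pi.single k.1 1 -
        fun j => (z (block ρ (k.1 + 1)) (block ρ k.1) j : ℝ) := by
      ext j
      by_cases h : j = k.1
      · subst h; simp [A]
      · simp [A, h]
    rw [e2, map_sub, hz']
    ext v
    simp [netFlow_single, Pi.single_apply, eq_comm]
  have h2 : ∀ (y : F → ℝ) (j : F), ∑ k, (A j k : ℝ) * y k = y j := by
    intro y j
    have : ∀ k : F, (A j k : ℝ) = if k = j then 1 else 0 := by
      intro k
      simp only [A, hz _ _ _ j.2, sub_zero]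
      by_cases h : k = j
      · subst h; simp
      · have : j.1 ≠ k.1 := fun h' => h (Subtype.ext h'.symm)
        simp [h, this]
    simp [this]
  refine ⟨A, h1, h2, fun x hx => ?_⟩
  have := hF.eq_of_eqOn hx (h1 fun k => x k) fun k hk =>
    (h2 (fun k => x k) ⟨k, hk⟩).symm
  exact congrFun this

/-! ### Noncrossing partitions and products of solutions. -/

theorem initialIndicator_sub_mul_mem (h : IsNoncrossing ρ) {i k j l : Fin n}
    (hik : block ρ i = block ρ k) (hjl : block ρ j = block ρ l) (h1 : i < k) (h2 : j < l)
    (hij : i ≤ j) :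
    (initialIndicator k - initialIndicator i) * (initialIndicator l - initialIndicator j) ∈
      solutionSpace ρ := by
  rcases le_or_gt k j with hkj | hkj
  · convert! (solutionSpace ρ).zero_mem using 1
    ext s
    simp only [initialIndicator, Pi.mul_apply, Pi.sub_apply, Pi.zero_apply, mul_eq_zero]
    rcases lt_or_ge s k with hs | hs
    · right
      rw [if_pos (hs.trans_le (hkj.trans h2.le)), if_pos (hs.trans_le hkj), sub_self]
    · left
      rw [if_neg hs.not_gt, if_neg (h1.le.trans hs).not_gt, sub_self]
  -- The segments `[i, k)` and `[j, l)` meet in `[j, m)` with `m = min k l`. The noncrossing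
  -- condition is needed only when `i < j < k < l`.
  · have key : ∀ m : Fin n, (m = k ∧ k ≤ l ∨ m = l ∧ l ≤ k) →
        (initialIndicator k - initialIndicator i) * (initialIndicator l - initialIndicator j) =
        initialIndicator m - initialIndicator j := by
      intro m hm
      ext s
      simp only [initialIndicator, Pi.mul_apply, Pi.sub_apply]
      have : s < m ↔ s < k ∧ s < l := by
        rcases hm with ⟨rfl, hm⟩ | ⟨rfl, hm⟩
        · exact ⟨fun h => ⟨h, h.trans_le hm⟩, fun h => h.1⟩
        · exact ⟨fun h => ⟨h.trans_le hm, h⟩, fun h => h.2⟩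
      by_cases hk : s < k
      · by_cases hi : s < i
        · have hj := hi.trans_le hij
          simp [this, hk, hi, hj, hj.trans h2]
        · simp [this, hk, hi]
      · have hj : ¬ s < j := fun h => hk (h.trans hkj)
        have hi : ¬ s < i := fun h => hk (h.trans h1)
        simp [this, hk, hi, hj]
    rcases le_or_gt l k with hlk | hkl
    · rw [key l (Or.inr ⟨rfl, hlk⟩), initialIndicator_sub_mem, hjl]
    · rw [key k (Or.inl ⟨rfl, hkl.le⟩), initialIndicator_sub_mem]
      rcases hij.eq_or_lt with rfl | hij
      · exact hik
      · exact (h i j k l hij hkj hkl hik hjl).2.1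

theorem mul_mem_solutionSpace (h : IsNoncrossing ρ) {x y : Fin n → ℝ}
    (hx : x ∈ solutionSpace ρ) (hy : y ∈ solutionSpace ρ) : x * y ∈ solutionSpace ρ := by
  have hlt : ∀ i k j l : Fin n, block ρ i = block ρ k → block ρ j = block ρ l → i < k → j < l →
      (initialIndicator k - initialIndicator i) * (initialIndicator l - initialIndicator j) ∈
        solutionSpace ρ := by
    intro i k j l hik hjl h1 h2
    rcases le_total i j with hij | hij
    · exact initialIndicator_sub_mul_mem h hik hjl h1 h2 hij
    · rw [mul_comm]
      exact initialIndicator_sub_mul_mem h hjl hik h2 h1 hij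
  have hle : ∀ i k j l : Fin n, block ρ i = block ρ k → block ρ j = block ρ l → i < k →
      (initialIndicator k - initialIndicator i) * (initialIndicator l - initialIndicator j) ∈
        solutionSpace ρ := by
    intro i k j l hik hjl h1
    rcases lt_trichotomy j l with h2 | rfl | h2
    · exact hlt i k j l hik hjl h1 h2
    · simp
    · rw [← neg_sub (initialIndicator j), mul_neg]
      exact neg_mem (hlt i k l j hik hjl.symm h1 h2)
  have hall : ∀ i k j l : Fin n, block ρ i = block ρ k → block ρ j = block ρ l →
      (initialIndicator k - initialIndicator i) * (initialIndicator l - initialIndicator j) ∈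
        solutionSpace ρ := by
    intro i k j l hik hjl
    rcases lt_trichotomy i k with h2 | rfl | h2
    · exact hle i k j l hik hjl h2
    · simp
    · rw [← neg_sub (initialIndicator i), neg_mul]
      exact neg_mem (hle k i j l hik.symm hjl h2)
  have hone : (fun _ : Fin n => (1 : ℝ)) = 1 := rfl
  rw [solutionSpace_eq_span, hone] at hx hy
  have := Submodule.mul_mem_mul hx hy
  rw [Submodule.span_mul_span] at this
  refine Submodule.span_le.2 ?_ this
  rintro _ ⟨x, (rfl | ⟨i, k, hik, rfl⟩), y, (rfl | ⟨j, l, hjl, rfl⟩), rfl⟩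
  · change (1 : Fin n → ℝ) * 1 ∈ solutionSpace ρ
    rw [mul_one]
    exact const_mem_solutionSpace ρ 1
  · simpa using (initialIndicator_sub_mem ρ).2 hjl
  · simpa using (initialIndicator_sub_mem ρ).2 hik
  · exact hall i k j l hik hjl

/-- For a noncrossing partition, each value of a solution is attained at a free variable. -/
theorem IsFreeVariables.exists_eq_of_isNoncrossing (hF : IsFreeVariables ρ F)
    (h : IsNoncrossing ρ) {x : Fin n → ℝ} (hx : x ∈ solutionSpace ρ) (j : Fin n) :
    ∃ k ∈ F, x j = x k := by
  have key : ∀ G : Finset (Fin n), (fun j => ∏ k ∈ G, (x j - x k)) ∈ solutionSpace ρ := by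
    intro G
    induction G using Finset.cons_induction with
    | empty => simpa using const_mem_solutionSpace ρ 1
    | cons a G ha ih =>
      simp only [Finset.prod_cons]
      exact mul_mem_solutionSpace h (sub_mem hx (const_mem_solutionSpace ρ (x a))) ih
  have h0 := hF.eq_of_eqOn (key F) (solutionSpace ρ).zero_mem fun k hk =>
    Finset.prod_eq_zero hk (sub_self _)
  obtain ⟨k, hk, h⟩ := Finset.prod_eq_zero_iff.1 (congrFun h0 j)
  exact ⟨k, hk, sub_eq_zero.1 h⟩

/-- If all values in `[0,1]` of the free variables belong to points of the polytope, then the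
partition is noncrossing. -/
theorem IsFreeVariables.isNoncrossing (hF : IsFreeVariables ρ F)
    (h : ∀ x ∈ solutionSpace ρ, (∀ k ∈ F, 0 ≤ x k ∧ x k ≤ 1) → ∀ k, 0 ≤ x k ∧ x k ≤ 1) :
    IsNoncrossing ρ := by
  intro i j k l hij hjk hkl hik hjl
  set a : Fin n → ℝ := initialIndicator k - initialIndicator i with ha
  set b : Fin n → ℝ := initialIndicator l - initialIndicator j with hb
  have hga : ∀ s, a s = 0 ∨ a s = 1 := by
    intro s
    by_cases h1 : s < i
    · simp [ha, initialIndicator, h1, h1.trans (hij.trans hjk)]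
    · by_cases h2 : s < k <;> simp [ha, initialIndicator, h1, h2]
  have hgb : ∀ s, b s = 0 ∨ b s = 1 := by
    intro s
    by_cases h1 : s < j
    · simp [hb, initialIndicator, h1, h1.trans (hjk.trans hkl)]
    · by_cases h2 : s < l <;> simp [hb, initialIndicator, h1, h2]
  have haS : a ∈ solutionSpace ρ := (initialIndicator_sub_mem ρ).2 hik
  have hbS : b ∈ solutionSpace ρ := (initialIndicator_sub_mem ρ).2 hjl
  obtain ⟨x, ⟨hx, hxF⟩, -⟩ := hF fun s => a s * b s
  have hxF' : ∀ s ∈ F, x s = a s * b s := fun s hs => hxF ⟨s, hs⟩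
  have h1 := h x hx fun s hs => by
    rw [hxF' s hs]
    rcases hga s with e | e <;> rcases hgb s with e' | e' <;> norm_num [e, e']
  have h2 := h (a - x) (sub_mem haS hx) fun s hs => by
    rw [Pi.sub_apply, hxF' s hs]
    rcases hga s with e | e <;> rcases hgb s with e' | e' <;> norm_num [e, e']
  have h3 := h (b - x) (sub_mem hbS hx) fun s hs => by
    rw [Pi.sub_apply, hxF' s hs]
    rcases hga s with e | e <;> rcases hgb s with e' | e' <;> norm_num [e, e']
  have h4 := h (a + b - x) (sub_mem (add_mem haS hbS) hx) fun s hs => by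
    rw [Pi.sub_apply, Pi.add_apply, hxF' s hs]
    rcases hga s with e | e <;> rcases hgb s with e' | e' <;> norm_num [e, e']
  -- The bounds on `x`, `a - x`, `b - x` and `a + b - x` give `max 0 (a + b - 1) ≤ x ≤ min a b`,
  -- which for 0-1 valued `a`, `b` forces `x = a * b`.
  have hxe : x = initialIndicator k - initialIndicator j := by
    ext s
    have hs1 := h1 s
    have hs2 := h2 s
    have hs3 := h3 s
    have hs4 := h4 s
    simp only [Pi.sub_apply, Pi.add_apply, ha, hb, initialIndicator] at hs2 hs3 hs4 ⊢
    by_cases c1 : s < i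
    · simp only [c1, c1.trans hij, c1.trans (hij.trans hjk), c1.trans (hij.trans (hjk.trans hkl)),
        if_true] at *
      linarith
    · by_cases c2 : s < j
      · simp only [c1, c2, c2.trans hjk, c2.trans (hjk.trans hkl), if_true, if_false] at *
        linarith
      · by_cases c3 : s < k
        · simp only [c1, c2, c3, c3.trans hkl, if_true, if_false] at *
          linarith
        · simp only [c1, c2, c3, if_false] at *
          linarith
  have hkj : block ρ j = block ρ k := (initialIndicator_sub_mem ρ).1 (hxe ▸ hx)
  exact ⟨hik.trans hkj.symm, hkj, hkj.symm.trans hjl⟩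

end VandermondeMoments

/-! ### Rationality of volumes of rational polytopes. -/

namespace VandermondeMoments

open MeasureTheory

/-- Affine functions on `ℝ^ι` with rational coefficients. -/
def IsRatAffine {ι : Type*} [Fintype ι] (l : (ι → ℝ) → ℝ) : Prop :=
  ∃ (a : ι → ℚ) (b : ℚ), ∀ y, l y = ∑ i, (a i : ℝ) * y i + b

namespace IsRatAffine

variable {ι : Type*} [Fintype ι] {l l' : (ι → ℝ) → ℝ}

theorem const (q : ℚ) : IsRatAffine (fun _ : ι → ℝ => (q : ℝ)) :=
  ⟨0, q, fun y => by simp⟩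

theorem sub (h : IsRatAffine l) (h' : IsRatAffine l') : IsRatAffine (fun y => l y - l' y) := by
  obtain ⟨a, b, hl⟩ := h
  obtain ⟨a', b', hl'⟩ := h'
  refine ⟨a - a', b - b', fun y => ?_⟩
  simp only [hl, hl', Pi.sub_apply, Rat.cast_sub, sub_mul, Finset.sum_sub_distrib]
  ring

theorem const_mul (q : ℚ) (h : IsRatAffine l) : IsRatAffine (fun y => (q : ℝ) * l y) := by
  obtain ⟨a, b, hl⟩ := h
  refine ⟨fun i => q * a i, q * b, fun y => ?_⟩
  simp only [hl, Rat.cast_mul, mul_add, Finset.mul_sum, mul_assoc]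

theorem continuous (h : IsRatAffine l) : Continuous l := by
  obtain ⟨a, b, hl⟩ := h
  rw [funext hl]
  fun_prop

end IsRatAffine

/-- The `ℚ`-algebra of functions on `ℝ^m` generated by the rational affine functions and the
indicator functions of the rational half-spaces. -/
noncomputable def piecewisePoly (m : ℕ) : Subalgebra ℚ ((Fin m → ℝ) → ℝ) :=
  Algebra.adjoin ℚ ({l | IsRatAffine l} ∪
    {f | ∃ l, IsRatAffine l ∧ f = fun y => if 0 ≤ l y then 1 else 0})

variable {m : ℕ}

theorem IsRatAffine.mem_piecewisePoly {l : (Fin m → ℝ) → ℝ} (h : IsRatAffine l) :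
    l ∈ piecewisePoly m :=
  Algebra.subset_adjoin (Or.inl h)

theorem IsRatAffine.ite_mem_piecewisePoly {l : (Fin m → ℝ) → ℝ} (h : IsRatAffine l) :
    (fun y => if 0 ≤ l y then 1 else 0) ∈ piecewisePoly m :=
  Algebra.subset_adjoin (Or.inr ⟨l, h, rfl⟩)

theorem IsRatAffine.ite_le_mem_piecewisePoly {l l' : (Fin m → ℝ) → ℝ} (h : IsRatAffine l)
    (h' : IsRatAffine l') : (fun y => if l y ≤ l' y then 1 else 0) ∈ piecewisePoly m := by
  simpa [sub_nonneg] using (h'.sub h).ite_mem_piecewisePoly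

theorem IsRatAffine.ite_lt_mem_piecewisePoly {l l' : (Fin m → ℝ) → ℝ} (h : IsRatAffine l)
    (h' : IsRatAffine l') : (fun y => if l y < l' y then 1 else 0) ∈ piecewisePoly m := by
  have := (piecewisePoly m).sub_mem (piecewisePoly m).one_mem (h'.ite_le_mem_piecewisePoly h)
  convert! this using 1
  ext y
  by_cases hy : l y < l' y
  · simp [hy, hy.not_ge]
  · simp [hy, not_lt.1 hy]

theorem const_mem_piecewisePoly (q : ℚ) : (fun _ => (q : ℝ)) ∈ piecewisePoly m :=
  (IsRatAffine.const q).mem_piecewisePoly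

/-- Uniform distribution on the unit cube. -/
noncomputable def cubeMeasure (m : ℕ) : Measure (Fin m → ℝ) :=
  Measure.pi fun _ => volume.restrict (Set.Icc (0 : ℝ) 1)

instance : IsProbabilityMeasure (volume.restrict (Set.Icc (0 : ℝ) 1)) := ⟨by simp⟩

instance : IsProbabilityMeasure (cubeMeasure m) := by
  unfold cubeMeasure; infer_instance

theorem cubeMeasure_eq : cubeMeasure m = volume.restrict (Set.Icc (0 : Fin m → ℝ) 1) := by
  rw [cubeMeasure, volume_pi, ← Set.pi_univ_Icc, Measure.restrict_pi_pi]
  rfl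

theorem measurable_and_bounded_of_mem_piecewisePoly {f : (Fin m → ℝ) → ℝ}
    (hf : f ∈ piecewisePoly m) :
    Measurable f ∧ ∃ B : ℝ, ∀ y ∈ Set.Icc (0 : Fin m → ℝ) 1, ‖f y‖ ≤ B := by
  induction hf using Algebra.adjoin_induction with
  | mem f hf =>
    rcases hf with hf | ⟨l, hl, rfl⟩
    · exact ⟨hf.continuous.measurable,
        isCompact_Icc.exists_bound_of_continuousOn hf.continuous.continuousOn⟩
    · refine ⟨Measurable.ite (measurableSet_le measurable_const hl.continuous.measurable)
        measurable_const measurable_const, 1, fun y _ => ?_⟩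
      dsimp only
      split_ifs <;> simp
  | algebraMap q => exact ⟨measurable_const, ‖(q : ℝ)‖, fun y _ => le_rfl⟩
  | add f g _ _ hf hg =>
    obtain ⟨hf, B, hB⟩ := hf
    obtain ⟨hg, B', hB'⟩ := hg
    exact ⟨hf.add hg, B + B', fun y hy => norm_add_le_of_le (hB y hy) (hB' y hy)⟩
  | mul f g _ _ hf hg =>
    obtain ⟨hf, B, hB⟩ := hf
    obtain ⟨hg, B', hB'⟩ := hg
    exact ⟨hf.mul hg, B * B', fun y hy => norm_mul_le_of_le (hB y hy) (hB' y hy)⟩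

theorem integrable_of_mem_piecewisePoly {f : (Fin m → ℝ) → ℝ} (hf : f ∈ piecewisePoly m) :
    Integrable f (cubeMeasure m) := by
  obtain ⟨hf, B, hB⟩ := measurable_and_bounded_of_mem_piecewisePoly hf
  refine Integrable.of_bound hf.aestronglyMeasurable B ?_
  rw [cubeMeasure_eq]
  exact (ae_restrict_mem measurableSet_Icc).mono hB

/-- The trivial function and the indicator functions of rational half-lines in the last variable,
depending on parameters. -/
def halfLineIndicators (m : ℕ) : Set ((Fin m → ℝ) × ℝ → ℝ) :=
  {h | h = 1 ∨ ∃ l, IsRatAffine l ∧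
    (h = (fun p => if l p.1 ≤ p.2 then 1 else 0) ∨ h = fun p => if l p.1 < p.2 then 1 else 0)}

/-- The intersection of two half-lines is the one with the larger threshold, and `c` decides which
that is. At equal thresholds of mixed type the strict one must win. -/
theorem exists_mul_eq_of_mem_halfLineIndicators {h h' : (Fin m → ℝ) × ℝ → ℝ}
    (hh : h ∈ halfLineIndicators m) (hh' : h' ∈ halfLineIndicators m) :
    ∃ c ∈ piecewisePoly m, ∀ p, h p * h' p = c p.1 * h p + (1 - c p.1) * h' p := by
  rcases hh with rfl | ⟨l, hl, rfl | rfl⟩ <;> rcases hh' with rfl | ⟨l', hl', rfl | rfl⟩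
  · exact ⟨0, zero_mem _, fun p => by simp⟩
  · exact ⟨0, zero_mem _, fun p => by simp⟩
  · exact ⟨0, zero_mem _, fun p => by simp⟩
  · exact ⟨1, one_mem _, fun p => by simp⟩
  · refine ⟨_, hl'.ite_le_mem_piecewisePoly hl, fun p => ?_⟩
    dsimp only
    split_ifs <;> first | (exfalso; linarith) | norm_num
  · refine ⟨_, hl'.ite_lt_mem_piecewisePoly hl, fun p => ?_⟩
    dsimp only
    split_ifs <;> first | (exfalso; linarith) | norm_num
  · exact ⟨1, one_mem _, fun p => by simp⟩
  · refine ⟨_, hl'.ite_le_mem_piecewisePoly hl, fun p => ?_⟩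
    dsimp only
    split_ifs <;> first | (exfalso; linarith) | norm_num
  · refine ⟨_, hl'.ite_le_mem_piecewisePoly hl, fun p => ?_⟩
    dsimp only
    split_ifs <;> first | (exfalso; linarith) | norm_num

/-- The functions on `ℝ^m × ℝ` which, as functions of the last variable, are combinations of
monomials times indicator functions of half-lines. -/
noncomputable def fiberwisePoly (m : ℕ) : Submodule ℚ ((Fin m → ℝ) × ℝ → ℝ) :=
  Submodule.span ℚ {g | ∃ c ∈ piecewisePoly m, ∃ k : ℕ, ∃ h ∈ halfLineIndicators m,
    g = fun p => c p.1 * p.2 ^ k * h p}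

theorem mem_fiberwisePoly {c : (Fin m → ℝ) → ℝ} (hc : c ∈ piecewisePoly m) (k : ℕ)
    {h : (Fin m → ℝ) × ℝ → ℝ} (hh : h ∈ halfLineIndicators m) :
    (fun p => c p.1 * p.2 ^ k * h p) ∈ fiberwisePoly m :=
  Submodule.subset_span ⟨c, hc, k, h, hh, rfl⟩

theorem one_mem_halfLineIndicators : 1 ∈ halfLineIndicators m := Or.inl rfl

theorem comp_fst_mem_fiberwisePoly {c : (Fin m → ℝ) → ℝ} (hc : c ∈ piecewisePoly m) :
    (fun p => c p.1) ∈ fiberwisePoly m := by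
  simpa using mem_fiberwisePoly hc 0 one_mem_halfLineIndicators

theorem halfLineIndicators_subset {h : (Fin m → ℝ) × ℝ → ℝ} (hh : h ∈ halfLineIndicators m) :
    h ∈ fiberwisePoly m := by
  simpa using mem_fiberwisePoly (one_mem _) 0 hh

theorem mul_mem_fiberwisePoly {f g : (Fin m → ℝ) × ℝ → ℝ} (hf : f ∈ fiberwisePoly m)
    (hg : g ∈ fiberwisePoly m) : f * g ∈ fiberwisePoly m := by
  have := Submodule.mul_mem_mul hf hg
  rw [fiberwisePoly, Submodule.span_mul_span] at this
  refine Submodule.span_le.2 ?_ this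
  rintro _ ⟨_, ⟨c, hc, k, h, hh, rfl⟩, _, ⟨c', hc', k', h', hh', rfl⟩, rfl⟩
  obtain ⟨d, hd, e⟩ := exists_mul_eq_of_mem_halfLineIndicators hh hh'
  have h1 := mem_fiberwisePoly (mul_mem (mul_mem hc hc') hd) (k + k') hh
  have h2 := mem_fiberwisePoly (mul_mem (mul_mem hc hc') (sub_mem (one_mem _) hd)) (k + k') hh'
  convert! add_mem h1 h2 using 1
  ext p
  simp only [Pi.mul_apply, Pi.add_apply, Pi.sub_apply, Pi.one_apply]
  rw [mul_mul_mul_comm, e]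
  ring

/-- A half-space condition, solved for the first variable, is a half-line, the complement of one, or
free of that variable, according to the sign of its coefficient. -/
theorem comp_cons_mem_fiberwisePoly {f : (Fin (m + 1) → ℝ) → ℝ} (hf : f ∈ piecewisePoly (m + 1)) :
    (fun p : (Fin m → ℝ) × ℝ => f (Fin.cons p.2 p.1)) ∈ fiberwisePoly m := by
  induction hf using Algebra.adjoin_induction with
  | mem f hf =>
    have key : ∀ l : (Fin (m + 1) → ℝ) → ℝ, IsRatAffine l → ∃ (a : ℚ) (l' : (Fin m → ℝ) → ℝ),
        IsRatAffine l' ∧ ∀ y t, l (Fin.cons t y) = a * t - l' y := by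
      rintro l ⟨a, b, hl⟩
      refine ⟨a 0, fun y => ∑ i, ((-a (Fin.succ i) : ℚ) : ℝ) * y i + (-b : ℚ), ⟨_, _, fun _ => rfl⟩,
        fun y t => ?_⟩
      simp only [hl, Fin.sum_univ_succ, Fin.cons_zero, Fin.cons_succ, Rat.cast_neg, neg_mul,
        Finset.sum_neg_distrib]
      ring
    rcases hf with hf | ⟨l, hl, rfl⟩
    · obtain ⟨a, l', hl', e⟩ := key f hf
      simp only [e]
      refine sub_mem ?_ (comp_fst_mem_fiberwisePoly hl'.mem_piecewisePoly)
      simpa using mem_fiberwisePoly (const_mem_piecewisePoly a) 1 one_mem_halfLineIndicators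
    · obtain ⟨a, l', hl', e⟩ := key l hl
      simp only [e]
      have hq := hl'.const_mul a⁻¹
      rcases lt_trichotomy a 0 with ha | rfl | ha
      · have h1 := sub_mem (halfLineIndicators_subset one_mem_halfLineIndicators)
          (halfLineIndicators_subset (Or.inr ⟨_, hq, Or.inr rfl⟩))
        convert! h1 using 1
        ext p
        have ha' : (a : ℝ) < 0 := by exact_mod_cast ha
        have : (0 ≤ (a : ℝ) * p.2 - l' p.1) ↔ ¬ ((a⁻¹ : ℚ) : ℝ) * l' p.1 < p.2 := by
          rw [Rat.cast_inv, not_lt, sub_nonneg, ← div_eq_inv_mul, le_div_iff_of_neg ha', mul_comm]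
        by_cases h : ((a⁻¹ : ℚ) : ℝ) * l' p.1 < p.2
        · rw [if_neg (by rw [this]; exact not_not.2 h)]
          simp only [Pi.sub_apply, Pi.one_apply, if_pos h, sub_self]
        · rw [if_pos (this.2 h)]
          simp only [Pi.sub_apply, Pi.one_apply, if_neg h, sub_zero]
      · simpa using comp_fst_mem_fiberwisePoly ((IsRatAffine.const 0).ite_le_mem_piecewisePoly
          ((hl'.const_mul (-1))))
      · have h1 := halfLineIndicators_subset (m := m) (Or.inr ⟨_, hq, Or.inl rfl⟩)
        convert! h1 using 1
        ext p
        have ha' : 0 < (a : ℝ) := by exact_mod_cast ha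
        have : (0 ≤ (a : ℝ) * p.2 - l' p.1) ↔ ((a⁻¹ : ℚ) : ℝ) * l' p.1 ≤ p.2 := by
          rw [Rat.cast_inv, sub_nonneg, ← div_eq_inv_mul, div_le_iff₀ ha', mul_comm]
        simp only [this]
  | algebraMap q => exact comp_fst_mem_fiberwisePoly (const_mem_piecewisePoly q)
  | add f g _ _ hf hg => exact add_mem hf hg
  | mul f g _ _ hf hg => exact mul_mem_fiberwisePoly hf hg

theorem clamp_mem_piecewisePoly {l : (Fin m → ℝ) → ℝ} (hl : IsRatAffine l) :
    (fun y => min (max 0 (l y)) 1) ∈ piecewisePoly m := by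
  have h0 := hl.ite_le_mem_piecewisePoly (IsRatAffine.const 0)
  have h1 := hl.ite_le_mem_piecewisePoly (IsRatAffine.const 1)
  have := mul_mem (sub_mem (one_mem _) h0)
    (add_mem (mul_mem h1 hl.mem_piecewisePoly) (sub_mem (one_mem _) h1))
  convert! this using 1
  ext y
  simp only [Pi.mul_apply, Pi.add_apply, Pi.sub_apply, Pi.one_apply, Rat.cast_zero, Rat.cast_one]
  split_ifs with h2 h3 h3
  · simp [h2]
  · linarith
  · rw [max_eq_right (not_le.1 h2).le, min_eq_left h3]; ring
  · rw [max_eq_right (not_le.1 h2).le, min_eq_right (not_le.1 h3).le]; ring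

/-- Clamping the threshold to `[0, 1]` makes one formula valid for every `l`. -/
theorem setIntegral_pow_ite (k : ℕ) (l : ℝ) :
    ∫ t in Set.Icc (0 : ℝ) 1, t ^ k * (if l ≤ t then 1 else 0) =
      (1 - (min (max 0 l) 1) ^ (k + 1)) * ((k + 1 : ℚ)⁻¹ : ℚ) := by
  have e : (fun t : ℝ => t ^ k * (if l ≤ t then 1 else 0)) =
      (Set.Ici l).indicator fun t => t ^ k := by
    ext t
    simp [Set.indicator_apply]
  have e2 : Set.Icc (0 : ℝ) 1 ∩ Set.Ici l = Set.Icc (max 0 l) 1 := by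
    ext t
    simp only [Set.mem_inter_iff, Set.mem_Icc, Set.mem_Ici, max_le_iff]
    tauto
  rw [e, setIntegral_indicator measurableSet_Ici, e2]
  push_cast
  rcases le_total (max 0 l) 1 with h | h
  · rw [integral_Icc_eq_integral_Ioc, ← intervalIntegral.integral_of_le h, integral_pow, one_pow,
      min_eq_left h, div_eq_mul_inv]
  · rw [min_eq_right h, one_pow, sub_self, zero_mul]
    rcases h.eq_or_lt with h | h
    · simp [← h]
    · simp [Set.Icc_eq_empty h.not_ge]

theorem integrableOn_pow_mul_ite (k : ℕ) (p : ℝ → Prop) [DecidablePred p]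
    (hp : MeasurableSet {t | p t}) :
    IntegrableOn (fun t : ℝ => t ^ k * (if p t then 1 else 0)) (Set.Icc 0 1) := by
  have h1 : IntegrableOn (fun t : ℝ => t ^ k) (Set.Icc 0 1) :=
    (continuous_pow k).continuousOn.integrableOn_Icc
  convert! h1.indicator hp using 1
  ext t
  simp [Set.indicator_apply]

theorem fiber_integral_mem_piecewisePoly {g : (Fin m → ℝ) × ℝ → ℝ} (hg : g ∈ fiberwisePoly m) :
    (fun y => ∫ t in Set.Icc (0 : ℝ) 1, g (y, t)) ∈ piecewisePoly m ∧
      ∀ y, IntegrableOn (fun t => g (y, t)) (Set.Icc 0 1) := by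
  induction hg using Submodule.span_induction with
  | mem g hg =>
    obtain ⟨c, hc, k, h, hh, rfl⟩ := hg
    simp only [mul_assoc, integral_const_mul]
    suffices hs : (fun y => ∫ t in Set.Icc (0 : ℝ) 1, t ^ k * h (y, t)) ∈ piecewisePoly m ∧
        ∀ y, IntegrableOn (fun t => t ^ k * h (y, t)) (Set.Icc 0 1) from
      ⟨mul_mem hc hs.1, fun y => (hs.2 y).const_mul _⟩
    rcases hh with rfl | ⟨l, hl, hh⟩
    · have := integral_pow (a := (0 : ℝ)) (b := 1) k
      rw [intervalIntegral.integral_of_le zero_le_one, ← integral_Icc_eq_integral_Ioc] at this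
      simp only [Pi.one_apply, mul_one, this]
      refine ⟨?_, fun y => (continuous_pow k).continuousOn.integrableOn_Icc⟩
      convert! const_mem_piecewisePoly (m := m) ((k + 1 : ℚ)⁻¹) using 1
      ext y
      simp
    · have hmem := mul_mem (sub_mem (one_mem _) (pow_mem (clamp_mem_piecewisePoly hl) (k + 1)))
        (const_mem_piecewisePoly (m := m) ((k + 1 : ℚ)⁻¹))
      rcases hh with rfl | rfl
      · refine ⟨?_, fun y => integrableOn_pow_mul_ite k (l y ≤ ·) measurableSet_Ici⟩
        simp only [setIntegral_pow_ite]
        exact hmem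
      · refine ⟨?_, fun y => integrableOn_pow_mul_ite k (l y < ·) measurableSet_Ioi⟩
        convert! hmem using 1
        ext y
        -- Strict and non-strict half-lines differ by a null set.
        have : ∫ t in Set.Icc (0 : ℝ) 1, t ^ k * (if l y < t then 1 else 0) =
            ∫ t in Set.Icc (0 : ℝ) 1, t ^ k * (if l y ≤ t then 1 else 0) := by
          apply integral_congr_ae
          filter_upwards [ae_restrict_of_ae (Measure.ae_ne volume (l y))] with t ht
          congr 2
          exact propext ⟨le_of_lt, fun h => lt_of_le_of_ne h (Ne.symm ht)⟩
        simp only [this, setIntegral_pow_ite]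
        rfl
  | zero => exact ⟨by
    convert! zero_mem (piecewisePoly m) using 1
    ext
    simp, fun y => integrableOn_zero⟩
  | add f g _ _ hf hg =>
    refine ⟨?_, fun y => (hf.2 y).add (hg.2 y)⟩
    convert! add_mem hf.1 hg.1 using 1
    ext y
    exact integral_add (hf.2 y) (hg.2 y)
  | smul q f _ hf =>
    refine ⟨?_, fun y => (hf.2 y).smul q⟩
    convert! Subalgebra.smul_mem _ hf.1 q using 1
    ext y
    exact integral_smul q _

theorem integral_cubeMeasure_succ {f : (Fin (m + 1) → ℝ) → ℝ} (hf : f ∈ piecewisePoly (m + 1)) :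
    ∫ x, f x ∂cubeMeasure (m + 1) =
      ∫ y, ∫ t in Set.Icc (0 : ℝ) 1, f (Fin.cons t y) ∂volume ∂cubeMeasure m := by
  have hmp := (measurePreserving_piFinSuccAbove
    (fun _ : Fin (m + 1) => volume.restrict (Set.Icc (0 : ℝ) 1)) 0).symm
  have hint := integrable_of_mem_piecewisePoly hf
  have h1 := hmp.integral_comp' (g := f)
  have h2 := (hmp.integrable_comp_emb (MeasurableEquiv.measurableEmbedding _) (g := f)).2 hint
  rw [cubeMeasure, ← h1]
  refine (integral_prod_symm _ h2).trans ?_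
  simp only [MeasurableEquiv.piFinSuccAbove]
  simp
  rfl

/-- Integrate out one variable at a time; in dimension zero only the rational constants remain. -/
theorem exists_rat_integral_eq {f : (Fin m → ℝ) → ℝ} (hf : f ∈ piecewisePoly m) :
    ∃ q : ℚ, ∫ x, f x ∂cubeMeasure m = q := by
  induction m with
  | zero =>
    have key : ∀ y, ∃ q : ℚ, f y = q := by
      intro y
      induction hf using Algebra.adjoin_induction with
      | mem f hf =>
        rcases hf with ⟨a, b, hl⟩ | ⟨l, hl, rfl⟩
        · exact ⟨b, by simp [hl]⟩
        · by_cases h : 0 ≤ l y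
          · exact ⟨1, by simp [h]⟩
          · exact ⟨0, by simp [h]⟩
      | algebraMap q => exact ⟨q, rfl⟩
      | add f g _ _ hf hg =>
        obtain ⟨q, hq⟩ := hf
        obtain ⟨r, hr⟩ := hg
        exact ⟨q + r, by simp [hq, hr]⟩
      | mul f g _ _ hf hg =>
        obtain ⟨q, hq⟩ := hf
        obtain ⟨r, hr⟩ := hg
        exact ⟨q * r, by simp [hq, hr]⟩
    obtain ⟨q, hq⟩ := key 0
    refine ⟨q, ?_⟩
    have : ∀ x, f x = q := fun x => by rw [Subsingleton.elim x 0, hq]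
    simp [this]
  | succ m ih =>
    rw [integral_cubeMeasure_succ hf]
    exact ih (fiber_integral_mem_piecewisePoly (comp_cons_mem_fiberwisePoly hf)).1

theorem exists_rat_volume_eq_fin {κ : Type*} [Fintype κ] (l : κ → (Fin m → ℝ) → ℝ)
    (hl : ∀ j, IsRatAffine (l j)) (hsub : {y | ∀ j, 0 ≤ l j y} ⊆ Set.Icc 0 1) :
    ∃ q : ℚ, volume.real {y | ∀ j, 0 ≤ l j y} = q := by
  have hmem : (∏ j, fun y => if 0 ≤ l j y then (1 : ℝ) else 0) ∈ piecewisePoly m :=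
    prod_mem fun j _ => (hl j).ite_mem_piecewisePoly
  obtain ⟨q, hq⟩ := exists_rat_integral_eq hmem
  refine ⟨q, ?_⟩
  have hmeas : MeasurableSet {y | ∀ j, 0 ≤ l j y} := by
    rw [Set.ofPred_forall]
    exact MeasurableSet.iInter fun j =>
      measurableSet_le measurable_const (hl j).continuous.measurable
  have e : (∏ j, fun y => if 0 ≤ l j y then (1 : ℝ) else 0) =
      {y | ∀ j, 0 ≤ l j y}.indicator 1 := by
    ext y
    rw [Finset.prod_apply, Set.indicator_apply]
    split_ifs with h
    · exact Finset.prod_eq_one fun j _ => if_pos (h j)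
    · obtain ⟨j, hj⟩ := not_forall.1 h
      exact Finset.prod_eq_zero (Finset.mem_univ j) (if_neg hj)
  rw [← hq, e, integral_indicator_one hmeas, cubeMeasure_eq, measureReal_restrict_apply hmeas,
    Set.inter_eq_left.2 hsub]

/-- The volume of a polytope in the unit cube which is given by rational inequalities is
rational. -/
theorem exists_rat_volume_eq {ι κ : Type*} [Fintype ι] [Fintype κ] (l : κ → (ι → ℝ) → ℝ)
    (hl : ∀ j, IsRatAffine (l j)) (hsub : {y | ∀ j, 0 ≤ l j y} ⊆ Set.Icc 0 1) :
    ∃ q : ℚ, volume.real {y | ∀ j, 0 ≤ l j y} = q := by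
  let e := Fintype.equivFin ι
  have hmp := volume_preserving_arrowCongr' e.symm (MeasurableEquiv.refl ℝ)
    (MeasurePreserving.id volume)
  have h := hmp.measure_preimage_equiv {y | ∀ j, 0 ≤ l j y}
  obtain ⟨q, hq⟩ := exists_rat_volume_eq_fin (fun j (y : Fin (Fintype.card ι) → ℝ) =>
      l j fun i => y (e i)) (fun j => by
    obtain ⟨a, b, hab⟩ := hl j
    refine ⟨fun i => a (e.symm i), b, fun y => ?_⟩
    simp only [hab, ← e.sum_comp, Equiv.symm_apply_apply]) (fun y hy => by
    have := hsub hy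
    refine ⟨fun i => ?_, fun i => ?_⟩
    · simpa using this.1 (e.symm i)
    · simpa using this.2 (e.symm i))
  exact ⟨q, by rw [← hq, measureReal_def, measureReal_def, ← h]; rfl⟩

end VandermondeMoments

/-! ### The expectation as a count of lattice points. -/

namespace VandermondeMoments

open MeasureTheory

variable {n : ℕ} [NeZero n] {ρ : Finpartition (Finset.univ : Finset (Fin n))}

instance : IsProbabilityMeasure uniformPhase :=
  ProbabilityTheory.cond_isProbabilityMeasure_of_finite (by simp [Real.pi_pos])
    (by rw [Real.volume_Ico]; exact ENNReal.ofReal_ne_top)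

theorem integral_exp_uniformPhase (m : ℤ) :
    ∫ t, Complex.exp (Complex.I * (m * t)) ∂uniformPhase = if m = 0 then 1 else 0 := by
  split_ifs with hm
  · simp [hm]
  · have hc : Complex.I * m ≠ 0 := mul_ne_zero Complex.I_ne_zero (Int.cast_ne_zero.2 hm)
    have h := integral_exp_mul_complex (a := 0) (b := 2 * Real.pi) hc
    rw [intervalIntegral.integral_of_le Real.two_pi_pos.le, ← integral_Ico_eq_integral_Ioc] at h
    rw [uniformPhase, ProbabilityTheory.cond, integral_smul_measure]
    simp only [← mul_assoc]
    rw [h]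
    have : Complex.I * m * ((2 * Real.pi : ℝ) : ℂ) = m * (2 * Real.pi * Complex.I) := by
      push_cast; ring
    rw [this, Complex.exp_int_mul_two_pi_mul_I]
    simp

theorem netFlow_intCast (z : Fin n → ℤ) (v : ρ.parts) :
    netFlow ρ (fun k => (z k : ℝ)) v =
      ((∑ k, if block ρ k = v then z (k - 1) - z k else 0 : ℤ) : ℝ) := by
  rw [netFlow_apply]
  push_cast
  rfl

/-- Collecting the exponent of each `ω v` gives minus the net flow of the shifted vector `z (· +
1)`: the difference `ω (b(k-1)) - ω (b(k))` belongs to the edge `k - 1`. -/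
theorem prod_exp_eq (z : Fin n → ℤ) (ω : ρ.parts → ℝ) :
    ∏ k, Complex.exp (Complex.I * (z k * (ω (block ρ (k - 1)) - ω (block ρ k) : ℝ))) =
      ∏ v, Complex.exp (Complex.I *
        ((-∑ k, if block ρ k = v then z (k - 1 + 1) - z (k + 1) else 0 : ℤ) * ω v)) := by
  rw [← Complex.exp_sum, ← Complex.exp_sum, ← Finset.mul_sum, ← Finset.mul_sum]
  congr 2
  have h := sum_netFlow_mul ρ ω (fun k => (z (k + 1) : ℝ))
  simp only [netFlow_intCast (ρ := ρ) fun k => z (k + 1)] at h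
  have h2 : ∑ k, (z k : ℝ) * (ω (block ρ (k - 1)) - ω (block ρ k)) =
      -∑ k, ω (block ρ k) * ((z (k - 1 + 1) : ℝ) - z (k + 1)) := by
    simp only [sub_add_cancel, mul_sub, Finset.sum_sub_distrib]
    rw [← Equiv.sum_comp (Equiv.addRight (1 : Fin n)) fun k => (z k : ℝ) * ω (block ρ (k - 1))]
    simp [mul_comm]
  rw [← h] at h2
  have h3 := congrArg (fun x : ℝ => (x : ℂ)) h2
  push_cast [apply_ite Complex.ofReal] at h3 ⊢
  rw [h3, ← Finset.sum_neg_distrib]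
  refine Finset.sum_congr rfl fun v _ => ?_
  ring

theorem integral_prod_exp (z : Fin n → ℤ) :
    ∫ ω : ρ.parts → ℝ, ∏ k, Complex.exp
        (Complex.I * (z k * (ω (block ρ (k - 1)) - ω (block ρ k) : ℝ)))
      ∂(Measure.pi fun _ => uniformPhase) =
      open Classical in if (fun k => (z (k + 1) : ℝ)) ∈ solutionSpace ρ then 1 else 0 := by
  simp only [prod_exp_eq]
  rw [integral_fintype_prod_eq_prod (𝕜 := ℂ) (fun (v : ρ.parts) (t : ℝ) => Complex.exp (Complex.I *
    ((-∑ k, if block ρ k = v then z (k - 1 + 1) - z (k + 1) else 0 : ℤ) * t)))]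
  simp only [integral_exp_uniformPhase, neg_eq_zero]
  rw [Finset.prod_ite_zero, Finset.prod_const_one]
  congr 1
  simp only [Finset.mem_univ, forall_true_left, mem_solutionSpace_iff, funext_iff,
    netFlow_intCast (ρ := ρ) fun k => z (k + 1), Pi.zero_apply, Int.cast_eq_zero]

open Classical in
/-- The solutions of the system with coordinates in `{0, …, N - 1}`. -/
noncomputable def latticeSolutions (ρ : Finpartition (Finset.univ : Finset (Fin n))) (N : ℕ) :
    Finset (Fin n → ℕ) :=
  (Fintype.piFinset fun _ => Finset.range N).filter fun r =>
    (fun k => (r k : ℝ)) ∈ solutionSpace ρ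

theorem mem_latticeSolutions {N : ℕ} {r : Fin n → ℕ} : r ∈ latticeSolutions ρ N ↔
    (∀ k, r k < N) ∧ (fun k => (r k : ℝ)) ∈ solutionSpace ρ := by
  simp [latticeSolutions]

theorem coeffN_eq (N : ℕ) : coeffN ρ uniformPhase N =
    (latticeSolutions ρ N).card / (N : ℂ) ^ (n + 1 - ρ.parts.card) := by
  classical
  have hint : ∀ r : Fin n → ℕ, Integrable (fun ω : ρ.parts → ℝ => ∏ k, Complex.exp
      (Complex.I * (r k * (ω (block ρ (k - 1)) - ω (block ρ k) : ℝ))))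
      (Measure.pi fun _ => uniformPhase) := by
    intro r
    refine Integrable.of_bound (C := 1) (Continuous.aestronglyMeasurable (by fun_prop)) ?_
    refine Filter.Eventually.of_forall fun ω => ?_
    rw [norm_prod]
    refine (Finset.prod_eq_one fun k _ => ?_).le
    have : Complex.I * (r k * (ω (block ρ (k - 1)) - ω (block ρ k) : ℝ)) =
        ((r k * (ω (block ρ (k - 1)) - ω (block ρ k)) : ℝ) : ℂ) * Complex.I := by
      push_cast; ring
    rw [this, Complex.norm_exp_ofReal_mul_I]
  rw [coeffN]
  simp only [phaseFactor_eq_sum, Finset.prod_univ_sum]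
  rw [integral_finsetSum _ fun r _ => hint r]
  have h : ∀ r : Fin n → ℕ, ∫ ω : ρ.parts → ℝ, ∏ k, Complex.exp
      (Complex.I * (r k * (ω (block ρ (k - 1)) - ω (block ρ k) : ℝ)))
      ∂(Measure.pi fun _ => uniformPhase) =
      if (fun k => (r (k + 1) : ℝ)) ∈ solutionSpace ρ then 1 else 0 := by
    intro r
    simpa using integral_prod_exp (ρ := ρ) fun k => (r k : ℤ)
  rw [Finset.sum_congr rfl fun r _ => h r, Finset.sum_boole, one_div, mul_comm, ← div_eq_mul_inv]
  congr 2
  refine Finset.card_bij (fun r _ k => r (k + 1)) ?_ ?_ ?_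
  · intro r hr
    rw [Finset.mem_filter, Fintype.mem_piFinset] at hr
    exact mem_latticeSolutions.2 ⟨fun k => Finset.mem_range.1 (hr.1 _), hr.2⟩
  · intro r _ s _ h
    ext k
    simpa using congrFun h (k - 1)
  · intro r hr
    rw [mem_latticeSolutions] at hr
    refine ⟨fun k => r (k - 1), ?_, by simp⟩
    rw [Finset.mem_filter, Fintype.mem_piFinset]
    exact ⟨fun k => Finset.mem_range.2 (hr.1 _), by simpa using hr.2⟩

end VandermondeMoments

/-! ### The limit as a volume, and when it equals 1. -/

namespace VandermondeMoments

open MeasureTheory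

variable {n : ℕ} [NeZero n] {ρ : Finpartition (Finset.univ : Finset (Fin n))} {F : Finset (Fin n)}

/-- `A` expresses the solutions in terms of the free variables `x_k`, `k ∈ F`. -/
structure IsSolutionMatrix (ρ : Finpartition (Finset.univ : Finset (Fin n))) (F : Finset (Fin n))
    (A : Matrix (Fin n) F ℤ) : Prop where
  mem : ∀ y : F → ℝ, (fun j => ∑ k, (A j k : ℝ) * y k) ∈ solutionSpace ρ
  apply_free : ∀ (y : F → ℝ) (j : F), ∑ k, (A j k : ℝ) * y k = y j
  eq : ∀ x ∈ solutionSpace ρ, ∀ j, x j = ∑ k, (A j k : ℝ) * x k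

/-- The projection of the polytope to the free variables. -/
def projPolytope (A : Matrix (Fin n) F ℤ) : Set (F → ℝ) :=
  {y | ∀ j, 0 ≤ ∑ k, (A j k : ℝ) * y k ∧ ∑ k, (A j k : ℝ) * y k ≤ 1}

/-- The half-open version of `projPolytope`. -/
def projPolytopeIco (A : Matrix (Fin n) F ℤ) : Set (F → ℝ) :=
  {y | ∀ j, 0 ≤ ∑ k, (A j k : ℝ) * y k ∧ ∑ k, (A j k : ℝ) * y k < 1}

theorem projPolytopeIco_subset (A : Matrix (Fin n) F ℤ) : projPolytopeIco A ⊆ projPolytope A :=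
  fun _ hy j => ⟨(hy j).1, (hy j).2.le⟩

theorem isLinearMap_coord (A : Matrix (Fin n) F ℤ) (j : Fin n) :
    IsLinearMap ℝ fun y : F → ℝ => ∑ k, (A j k : ℝ) * y k where
  map_add y z := by simp [mul_add, Finset.sum_add_distrib]
  map_smul c y := by simp [Finset.mul_sum, mul_left_comm]

theorem continuous_coord (A : Matrix (Fin n) F ℤ) (j : Fin n) :
    Continuous fun y : F → ℝ => ∑ k, (A j k : ℝ) * y k := by
  fun_prop

theorem convex_projPolytopeIco (A : Matrix (Fin n) F ℤ) : Convex ℝ (projPolytopeIco A) := by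
  simp only [projPolytopeIco, Set.ofPred_forall, Set.ofPred_and]
  exact convex_iInter fun j => (convex_halfSpace_ge (isLinearMap_coord A j) 0).inter
    (convex_halfSpace_lt (isLinearMap_coord A j) 1)

theorem isClosed_projPolytope (A : Matrix (Fin n) F ℤ) : IsClosed (projPolytope A) := by
  simp only [projPolytope, Set.ofPred_forall, Set.ofPred_and]
  exact isClosed_iInter fun j => (isClosed_le continuous_const (continuous_coord A j)).inter
    (isClosed_le (continuous_coord A j) continuous_const)

theorem measurableSet_projPolytopeIco (A : Matrix (Fin n) F ℤ) :
    MeasurableSet (projPolytopeIco A) := by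
  simp only [projPolytopeIco, Set.ofPred_forall, Set.ofPred_and]
  exact MeasurableSet.iInter fun j =>
    (measurableSet_le measurable_const (continuous_coord A j).measurable).inter
    (measurableSet_lt (continuous_coord A j).measurable measurable_const)

/-- Points of the closed body are limits of `t • y` with `t < 1`, which satisfy the strict upper
bounds. -/
theorem closure_projPolytopeIco (A : Matrix (Fin n) F ℤ) :
    closure (projPolytopeIco A) = projPolytope A := by
  apply le_antisymm
  · exact closure_minimal (projPolytopeIco_subset A) (isClosed_projPolytope A)
  · intro y hy
    have h0 : (fun t : ℝ => t • y) 1 = y := one_smul _ _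
    have hcont : ContinuousWithinAt (fun t : ℝ => t • y) (Set.Ico 0 1) 1 := by fun_prop
    rw [← h0]
    refine hcont.mem_closure (by rw [closure_Ico zero_ne_one]; simp) ?_
    intro t ht j
    have hlin := (isLinearMap_coord A j).map_smul t y
    dsimp only at hlin ⊢
    rw [hlin, smul_eq_mul]
    exact ⟨mul_nonneg ht.1 (hy j).1, mul_lt_one_of_nonneg_of_lt_one_left ht.1 ht.2 (hy j).2⟩

theorem volume_projPolytopeIco (A : Matrix (Fin n) F ℤ) :
    volume (projPolytopeIco A) = volume (projPolytope A) := by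
  rw [← closure_projPolytopeIco]
  exact (measure_closure_of_null_frontier ((convex_projPolytopeIco A).addHaar_frontier _)).symm

theorem exists_rat_volume_projPolytope {A : Matrix (Fin n) F ℤ}
    (hsub : projPolytope A ⊆ Set.Icc 0 1) : ∃ q : ℚ, volume.real (projPolytope A) = q := by
  have e : projPolytope A = {y | ∀ j : Fin n ⊕ Fin n, 0 ≤
      (Sum.elim (fun j y => ∑ k, (A j k : ℝ) * y k) (fun j y => 1 - ∑ k, (A j k : ℝ) * y k) :
        Fin n ⊕ Fin n → (F → ℝ) → ℝ) j y} := by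
    ext y
    simp only [projPolytope, Set.mem_ofPred_eq, Sum.forall, Sum.elim_inl, Sum.elim_inr,
      sub_nonneg, forall_and]
  rw [e] at hsub ⊢
  refine exists_rat_volume_eq _ ?_ hsub
  have h : ∀ j, IsRatAffine fun y : F → ℝ => ∑ k, (A j k : ℝ) * y k :=
    fun j => ⟨fun k => A j k, 0, fun y => by simp⟩
  rintro (j | j)
  · exact h j
  · simpa using (IsRatAffine.const 1).sub (h j)

namespace IsSolutionMatrix

variable {A : Matrix (Fin n) F ℤ}

theorem projPolytope_subset (hA : IsSolutionMatrix ρ F A) : projPolytope A ⊆ Set.Icc 0 1 := by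
  intro y hy
  refine ⟨fun k => ?_, fun k => ?_⟩
  · exact hA.apply_free y k ▸ (hy k).1
  · exact hA.apply_free y k ▸ (hy k).2

theorem image_polytope (hA : IsSolutionMatrix ρ F A) :
    (fun (x : Fin n → ℝ) (k : F) => x k) '' polytope ρ = projPolytope A := by
  ext y
  constructor
  · rintro ⟨x, ⟨hx, hxS⟩, rfl⟩ j
    rw [← hA.eq x hxS]
    exact hx j
  · intro hy
    exact ⟨_, ⟨hy, hA.mem y⟩, funext fun k => hA.apply_free y k⟩

theorem sum_eq_one (hA : IsSolutionMatrix ρ F A) (j : Fin n) (c : ℝ) : ∑ k, (A j k : ℝ) * c = c :=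
  (hA.eq _ (const_mem_solutionSpace ρ c) j).symm

theorem volume_projPolytope_pos (hA : IsSolutionMatrix ρ F A) : 0 < volume (projPolytope A) := by
  have hopen : IsOpen {y : F → ℝ | ∀ j, 0 < ∑ k, (A j k : ℝ) * y k ∧
      ∑ k, (A j k : ℝ) * y k < 1} := by
    simp only [Set.ofPred_forall, Set.ofPred_and]
    exact isOpen_iInter_of_finite fun j =>
      (isOpen_lt continuous_const (continuous_coord A j)).inter
      (isOpen_lt (continuous_coord A j) continuous_const)
  -- The constant point `1 / 2` is interior, because constants are solutions and so the rows of `A`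
  -- sum to 1.
  refine (hopen.measure_pos volume ⟨fun _ => 1 / 2, fun j => ?_⟩).trans_le
    (measure_mono fun y hy j => ⟨(hy j).1.le, (hy j).2.le⟩)
  rw [hA.sum_eq_one]
  norm_num

theorem volume_projPolytope_le_one (hA : IsSolutionMatrix ρ F A) : volume (projPolytope A) ≤ 1 := by
  refine (measure_mono hA.projPolytope_subset).trans ?_
  simp [Real.volume_Icc_pi]

theorem volume_projPolytope_eq_one_iff (hA : IsSolutionMatrix ρ F A) :
    volume (projPolytope A) = 1 ↔ Set.Icc 0 1 ⊆ projPolytope A := by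
  constructor
  · intro h y hy
    by_contra hyP
    -- A missed point of the cube may lie on its boundary; nearby interior points are missed too,
    -- and they fill an open set of positive measure.
    have hcl : y ∈ closure (interior (Set.Icc (0 : F → ℝ) 1)) := by
      rw [← Set.pi_univ_Icc, interior_pi_set Set.finite_univ, closure_pi_set]
      intro k _
      simp only [interior_Icc]
      rw [closure_Ioo (by simp)]
      exact ⟨hy.1 k, hy.2 k⟩
    obtain ⟨z, hz, hz'⟩ := mem_closure_iff.1 hcl _ (isClosed_projPolytope A).isOpen_compl hyP
    have hpos := ((isClosed_projPolytope A).isOpen_compl.inter isOpen_interior).measure_pos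
      volume ⟨z, hz, hz'⟩
    have hle : volume ((projPolytope A)ᶜ ∩ interior (Set.Icc 0 1)) ≤
        volume (Set.Icc (0 : F → ℝ) 1 \ projPolytope A) :=
      measure_mono fun w hw => ⟨interior_subset hw.2, hw.1⟩
    rw [measure_sdiff hA.projPolytope_subset
      (isClosed_projPolytope A).measurableSet.nullMeasurableSet (by simp [h]), h,
      Real.volume_Icc_pi] at hle
    simp only [Pi.one_apply, Pi.zero_apply, sub_zero, ENNReal.ofReal_one, Finset.prod_const_one,
      tsub_self] at hle
    exact hpos.not_ge hle
  · intro h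
    rw [hA.projPolytope_subset.antisymm h]
    simp [Real.volume_Icc_pi]

theorem Icc_subset_projPolytope_iff (hA : IsSolutionMatrix ρ F A) (hF : IsFreeVariables ρ F) :
    Set.Icc 0 1 ⊆ projPolytope A ↔ IsNoncrossing ρ := by
  constructor
  · intro h
    refine hF.isNoncrossing fun x hx hxF j => ?_
    rw [hA.eq x hx]
    exact h ⟨fun k => (hxF k k.2).1, fun k => (hxF k k.2).2⟩ j
  · intro h y hy j
    obtain ⟨k, hk, e⟩ := hF.exists_eq_of_isNoncrossing h (hA.mem y) j
    have e' := e.trans (hA.apply_free y ⟨k, hk⟩)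
    rw [e']
    exact ⟨hy.1 _, hy.2 _⟩

open scoped Pointwise in
-- Scaling by `N⁻¹` and restricting to `F` is the bijection. Surjectivity is where integrality of
-- `A` is used: the remaining coordinates are integers automatically. The range `{0, …, N - 1}`
-- matches the half-open body.
theorem card_latticeSolutions (hA : IsSolutionMatrix ρ F A) {N : ℕ} (hN : N ≠ 0) :
    Nat.card ↑(projPolytopeIco A ∩
      (N : ℝ)⁻¹ • (Submodule.span ℤ (Set.range (Pi.basisFun ℝ F)) : Set (F → ℝ))) =
      (latticeSolutions ρ N).card := by
  have : NeZero N := ⟨hN⟩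
  have hN' : 0 < (N : ℝ) := by positivity
  have hscale : ∀ (y : F → ℝ) j, ∑ k, (A j k : ℝ) * (N * y k) = N * ∑ k, (A j k : ℝ) * y k := by
    intro y j
    rw [Finset.mul_sum]
    exact Finset.sum_congr rfl fun k _ => by ring
  have hrec : ∀ r ∈ latticeSolutions ρ N, ∀ j,
      (r j : ℝ) = N * ∑ k : F, (A j k : ℝ) * ((N : ℝ)⁻¹ * r k) := by
    intro r hr j
    rw [← hscale, hA.eq _ (mem_latticeSolutions.1 hr).2 j]
    simp [mul_inv_cancel_left₀ hN'.ne']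
  rw [Nat.card_coe_set_eq, ← Set.ncard_coe_finset]
  symm
  refine Set.ncard_congr (fun r _ (k : F) => (N : ℝ)⁻¹ * r k) ?_ ?_ ?_
  · intro r hr
    refine ⟨fun j => ?_, ?_⟩
    · have h := hrec r hr j
      have hlt : (r j : ℝ) < N := by exact_mod_cast (mem_latticeSolutions.1 hr).1 j
      have h0 : 0 ≤ (r j : ℝ) := by positivity
      rw [h] at hlt h0
      exact ⟨nonneg_of_mul_nonneg_right h0 hN', by
        rwa [mul_lt_iff_lt_one_right hN'] at hlt⟩
    · rw [← Submodule.coe_pointwise_smul, SetLike.mem_coe,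
        BoxIntegral.unitPartition.mem_smul_span_iff]
      exact fun k => ⟨r k, by simp [mul_inv_cancel_left₀ hN'.ne']⟩
  · intro r s hr hs h
    ext j
    have hr' := hrec r hr j
    have hs' := hrec s hs j
    have h' := fun k : F => congrFun h k
    simp only [h'] at hr'
    exact_mod_cast hr'.trans hs'.symm
  · rintro y ⟨hy, hy'⟩
    rw [← Submodule.coe_pointwise_smul, SetLike.mem_coe,
      BoxIntegral.unitPartition.mem_smul_span_iff] at hy'
    choose m hm using hy'
    simp only [algebraMap_int_eq, eq_intCast] at hm
    have hx : ∀ j, (N : ℝ) * ∑ k, (A j k : ℝ) * y k = ((∑ k, A j k * m k : ℤ) : ℝ) := by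
      intro j
      rw [← hscale]
      push_cast
      simp only [hm]
    have hnn : ∀ j, 0 ≤ ∑ k, A j k * m k := fun j => by
      have := mul_nonneg hN'.le (hy j).1
      rw [hx] at this
      exact_mod_cast this
    have htn : ∀ j, (((∑ k, A j k * m k).toNat : ℕ) : ℝ) = N * ∑ k, (A j k : ℝ) * y k := by
      intro j
      rw [hx, ← Int.cast_natCast, Int.toNat_of_nonneg (hnn j)]
    refine ⟨fun j => (∑ k, A j k * m k).toNat, mem_latticeSolutions.2 ⟨fun j => ?_, ?_⟩, ?_⟩
    · have := mul_lt_of_lt_one_right hN' (hy j).2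
      rw [← htn] at this
      exact_mod_cast this
    · simp only [htn]
      exact (solutionSpace ρ).smul_mem (N : ℝ) (hA.mem y)
    · ext k
      rw [htn, inv_mul_cancel_left₀ hN'.ne', hA.apply_free]

theorem tendsto_coeffN (hA : IsSolutionMatrix ρ F A) (hF : IsFreeVariables ρ F) :
    Filter.Tendsto (fun N : ℕ => coeffN ρ uniformPhase N) Filter.atTop
      (nhds ((volume.real (projPolytope A) : ℝ) : ℂ)) := by
  have h := tendsto_card_div_pow_atTop_volume (projPolytopeIco A)
    ((Metric.isBounded_Icc (0 : F → ℝ) 1).subset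
      ((projPolytopeIco_subset A).trans hA.projPolytope_subset))
    (measurableSet_projPolytopeIco A) ((convex_projPolytopeIco A).addHaar_frontier _)
  rw [measureReal_def, volume_projPolytopeIco, ← measureReal_def] at h
  refine ((Complex.continuous_ofReal.tendsto _).comp h).congr' ?_
  filter_upwards [Filter.eventually_ne_atTop 0] with N hN
  rw [Function.comp_apply, hA.card_latticeSolutions hN, coeffN_eq, ← hF.card_eq, Fintype.card_coe]
  push_cast
  rfl

end IsSolutionMatrix

theorem IsFreeVariables.exists_isSolutionMatrix (hF : IsFreeVariables ρ F) :
    ∃ A, IsSolutionMatrix ρ F A := by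
  obtain ⟨A, h1, h2, h3⟩ := hF.exists_matrix
  exact ⟨A, h1, h2, h3⟩

end VandermondeMoments

theorem proposition1 (n : ℕ) [NeZero n] (ρ : Finpartition (Finset.univ : Finset (Fin n))) :
    ∃ K : ℚ,
      Filter.Tendsto
        (fun N : ℕ => VandermondeMoments.coeffN ρ VandermondeMoments.uniformPhase N)
        Filter.atTop (nhds (K : ℂ)) ∧
      0 < K ∧ K ≤ 1 ∧
      (K = 1 ↔ VandermondeMoments.IsNoncrossing ρ) ∧
      Module.finrank ℝ (VandermondeMoments.solutionSpace ρ) = n + 1 - ρ.parts.card ∧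
      (∃ F : Finset (Fin n), VandermondeMoments.IsFreeVariables ρ F) ∧
      ∀ F : Finset (Fin n), VandermondeMoments.IsFreeVariables ρ F →
        F.card = n + 1 - ρ.parts.card ∧
        VandermondeMoments.polytopeVolume ρ F = ENNReal.ofReal (K : ℝ) := by
  open VandermondeMoments MeasureTheory in
  obtain ⟨F, hF⟩ := exists_isFreeVariables ρ
  obtain ⟨A, hA⟩ := hF.exists_isSolutionMatrix
  obtain ⟨K, hK⟩ := exists_rat_volume_projPolytope hA.projPolytope_subset
  have hlim := hA.tendsto_coeffN hF
  rw [hK] at hlim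
  have hfin := ne_top_of_le_ne_top ENNReal.one_ne_top hA.volume_projPolytope_le_one
  have hpos := ENNReal.toReal_pos hA.volume_projPolytope_pos.ne' hfin
  have hle := ENNReal.toReal_mono ENNReal.one_ne_top hA.volume_projPolytope_le_one
  rw [← measureReal_def, hK] at hpos hle
  refine ⟨K, by simpa using hlim, by exact_mod_cast hpos, by exact_mod_cast hle, ?_,
    finrank_solutionSpace ρ, ⟨F, hF⟩, fun G hG => ⟨hG.card_eq, ?_⟩⟩
  · rw [← hA.Icc_subset_projPolytope_iff hF, ← hA.volume_projPolytope_eq_one_iff,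
      ← ENNReal.toReal_eq_one_iff, ← measureReal_def, hK]
    norm_cast
  · obtain ⟨B, hB⟩ := hG.exists_isSolutionMatrix
    -- Both volumes are limits of the same sequence, so no change of coordinates between `F` and `G`
    -- is needed.
    have h := tendsto_nhds_unique (hB.tendsto_coeffN hG) hlim
    rw [polytopeVolume, hB.image_polytope, ← Complex.ofReal_injective h, measureReal_def,
      ENNReal.ofReal_toReal]
    exact ne_top_of_le_ne_top ENNReal.one_ne_top hB.volume_projPolytope_le_one
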